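/- Let $N\ge 1$, let $0<n_1<\dots<n_N$ be integers and let $a_1,\dots,a_N\in\mathbb C$ be not all zero. For $x\in\mathbb T=\mathbb R/2\pi\mathbb Z$ write $$P(x)=\sum_{k=1}^N a_k e^{in_kx}=f(x)+i\widetilde f(x),\qquad f=\operatorname{Re}P,\quad \widetilde f=\operatorname{Im}P,$$ and put $M=-\min_{x\in\mathbb T}f(x)$ and $\|\widetilde f\|_\infty=\max_{x\in\mathbb T}|\widetilde f(x)|$. Let $\mathsf G=\sum_{j=0}^\infty\frac{(-1)^j}{(2j+1)^2}$ be Catalan's constant and, for $p>1$, $A_p=p\int_0^1\frac{t^{p-1}}{\sin(\pi t/2)}\,dt$. Then $A_2=\frac{16\,\mathsf G}{\pi^2}$ (the integral being convergent), $\|\widetilde f\|_\infty>0$, and $$M\ \ge\ \frac{\pi^2}{32\,\mathsf G}\cdot\frac{\sum_{k=1}^N|a_k|^2}{\|\widetilde f\|_\infty}.$$ In particular, if $|a_k|\ge 1$ for all $k$, then $$M\ \ge\ \frac{\pi^2}{32\,\mathsf G}\cdot\frac{N}{\|\widetilde f\|_\infty}.$$ The last bound is of optimal order in $N$: there is a sequence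 $\varepsilon_1,\varepsilon_2,\dots\in\{-1,1\}$ such that for every $N\ge1$ the polynomial with $n_k=k$ and $a_k=\varepsilon_k$ $(1\le k\le N)$ satisfies $$M\ \le\ 25\cdot\frac{N}{\|\widetilde f\|_\infty}.$$ -/

import Mathlib

open scoped Real

noncomputable section

namespace TrigPoly

/-- The circle `ℝ / 2πℤ`. -/
abbrev Torus : Type := AddCircle (2 * π)

instance fact_two_pi_pos : Fact (0 < 2 * π) := ⟨Real.two_pi_pos⟩

/-- The trigonometric polynomial `P(x) = ∑ k, a k * exp (i * n k * x)` on the circle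
(see `poly_coe` for the exponential form). -/
def poly {N : ℕ} (n : Fin N → ℕ) (a : Fin N → ℂ) (x : Torus) : ℂ :=
  ∑ k, a k * fourier (T := 2 * π) (n k : ℤ) x

/-- The real part `f` of `P = f + i f̃`. -/
def re {N : ℕ} (n : Fin N → ℕ) (a : Fin N → ℂ) (x : Torus) : ℝ := (poly n a x).re

/-- The conjugate function `f̃`, the imaginary part of `P = f + i f̃`. -/
def conj {N : ℕ} (n : Fin N → ℕ) (a : Fin N → ℂ) (x : Torus) : ℝ := (poly n a x).im

/-- `M = - min f`; the minimum is attained, see `isLeast_neg_negMin`. -/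
def negMin {N : ℕ} (n : Fin N → ℕ) (a : Fin N → ℂ) : ℝ := -(⨅ x : Torus, re n a x)

/-- The sup norm of the conjugate function; it is attained, see `isGreatest_conjSup`. -/
def conjSup {N : ℕ} (n : Fin N → ℕ) (a : Fin N → ℂ) : ℝ := ⨆ x : Torus, |conj n a x|

/-- `A_p = p * ∫₀¹ t ^ (p - 1) / sin (π t / 2) dt`. -/
def A (p : ℝ) : ℝ := p * ∫ t in (0 : ℝ)..1, t ^ (p - 1) / Real.sin (π * t / 2)

/-- Catalan's constant; the series converges, see `summable_catalan`. -/
def catalanConst : ℝ := ∑' j : ℕ, (-1 : ℝ) ^ j / (2 * (j : ℝ) + 1) ^ 2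

theorem poly_coe {N : ℕ} (n : Fin N → ℕ) (a : Fin N → ℂ) (x : ℝ) :
    poly n a (x : Torus) = ∑ k, a k * Complex.exp (Complex.I * (n k : ℂ) * (x : ℂ)) := by
  unfold poly
  refine Finset.sum_congr rfl fun k _ => ?_
  rw [fourier_coe_apply]
  congr 2
  have : (π : ℂ) ≠ 0 := by exact_mod_cast Real.pi_ne_zero
  push_cast
  field_simp

theorem continuous_poly {N : ℕ} (n : Fin N → ℕ) (a : Fin N → ℂ) : Continuous (poly n a) := by
  unfold poly
  fun_prop

theorem isLeast_neg_negMin {N : ℕ} (n : Fin N → ℕ) (a : Fin N → ℂ) :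
    IsLeast (Set.range (re n a)) (-negMin n a) := by
  have hc : Continuous (re n a) := Complex.continuous_re.comp (continuous_poly n a)
  have h := (isCompact_range hc).isLeast_sInf (Set.range_nonempty _)
  simpa [negMin, iInf] using h

theorem isGreatest_conjSup {N : ℕ} (n : Fin N → ℕ) (a : Fin N → ℂ) :
    IsGreatest (Set.range fun x => |conj n a x|) (conjSup n a) := by
  have hc : Continuous (fun x => |conj n a x|) :=
    (Complex.continuous_im.comp (continuous_poly n a)).abs
  exact (isCompact_range hc).isGreatest_sSup (Set.range_nonempty _)

theorem summable_catalan : Summable fun j : ℕ => (-1 : ℝ) ^ j / (2 * (j : ℝ) + 1) ^ 2 := by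
  have h : Summable fun j : ℕ => 1 / ((j + 1 : ℕ) : ℝ) ^ 2 :=
    (summable_nat_add_iff 1).2 (Real.summable_one_div_nat_pow.2 (by norm_num))
  refine Summable.of_norm_bounded h fun j => ?_
  rw [norm_div, norm_pow, norm_neg, norm_one, one_pow, Real.norm_of_nonneg (by positivity)]
  push_cast
  gcongr
  linarith [(Nat.cast_nonneg j : (0 : ℝ) ≤ j)]

end TrigPoly

end

/-! Lower bound. With `q = π / (2 * conjSup n a)`, the function F = q(P + M) is a polynomial in z
whose values on the unit circle lie in the half-strip Re ≥ 0, |Im| ≤ π/2, and F(0) = qM because all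
frequencies are positive. On this half-strip φ² has the harmonic majorant u(x, φ) = π²/4 - (8/π) ∑
(-1)^k e^{-(2k+1)x} cos((2k+1)φ) / (2k+1)³: at x = 0 it is the Fourier series of φ², and it is at
least φ² for x ≥ 0 (`sum_exp_mul_sin_le`). The mean value property bounds the mean of (Im F)² by
u(qM, 0), and u(h, 0) ≤ (8/π) G h (`sum_exp_remainder_nonneg`). Since (Im P)² has mean (∑ |a_k|²)/2,
dividing by q gives the claim. Both inequalities for u come from Abel summation against ∑
sin((2k+1)θ) = sin²(Kθ) / sin θ ≥ 0. The same identity with the Riemann–Lebesgue lemma evaluates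
A_2. Optimality. Partial sums with Rudin–Shapiro signs are at most 5√N on the circle, so both M and
the conjugate norm are, and their product is at most 25N. -/

/-! ### Rudin–Shapiro signs and the bound 5√N for every partial sum. -/

namespace RudinShapiro

/-- The exponent is the parity of the number of adjacent pairs 11 in the binary expansion of `n`:
for odd `n`, the parity of `n / 2` is the next digit. -/
noncomputable def sign (n : ℕ) : ℝ :=
  if n = 0 then 1 else if n % 2 = 0 then sign (n / 2) else (-1) ^ (n / 2) * sign (n / 2)
termination_by n
decreasing_by all_goals omega

theorem sign_two_mul (n : ℕ) : sign (2 * n) = sign n := by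
  rcases Nat.eq_zero_or_pos n with rfl | h
  · rfl
  · rw [sign, if_neg (by omega), if_pos (by omega), Nat.mul_div_cancel_left _ two_pos]

theorem sign_two_mul_add_one (n : ℕ) : sign (2 * n + 1) = (-1) ^ n * sign n := by
  rw [sign, if_neg (by omega), if_neg (by omega), show (2 * n + 1) / 2 = n by omega]

theorem sign_eq_one_or (n : ℕ) : sign n = 1 ∨ sign n = -1 := by
  induction n using Nat.strong_induction_on with
  | _ n ih =>
    rcases Nat.eq_zero_or_pos n with rfl | h
    · left; rw [sign, if_pos rfl]
    · obtain ⟨k, hk⟩ := Nat.even_or_odd' n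
      rcases hk with rfl | rfl
      · rw [sign_two_mul]; exact ih k (by omega)
      · rw [sign_two_mul_add_one]
        rcases ih k (by omega) with h1 | h1 <;> rcases neg_one_pow_eq_or ℝ k with h2 | h2 <;>
          simp [h1, h2]

theorem norm_sign (n : ℕ) : ‖(sign n : ℂ)‖ = 1 := by
  rcases sign_eq_one_or n with h | h <;> simp [h]

noncomputable def partialSum (N : ℕ) (z : ℂ) : ℂ := ∑ k ∈ Finset.range N, (sign k : ℂ) * z ^ k

theorem partialSum_succ (N : ℕ) (z : ℂ) :
    partialSum (N + 1) z = partialSum N z + (sign N : ℂ) * z ^ N := Finset.sum_range_succ _ _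

theorem partialSum_two_mul (N : ℕ) (z : ℂ) :
    partialSum (2 * N) z = partialSum N (z ^ 2) + z * partialSum N (-z ^ 2) := by
  induction N with
  | zero => simp [partialSum]
  | succ N ih =>
    rw [show 2 * (N + 1) = 2 * N + 1 + 1 by ring, partialSum_succ, partialSum_succ, ih,
      partialSum_succ, partialSum_succ, sign_two_mul, sign_two_mul_add_one, neg_pow (z ^ 2)]
    push_cast
    ring

/-- The values at `z` and `-z` are the sum and the difference of the same two numbers, so this is
the parallelogram law. -/
theorem norm_sq_partialSum_two_mul (N : ℕ) {z : ℂ} (hz : ‖z‖ = 1) :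
    ‖partialSum (2 * N) z‖ ^ 2 + ‖partialSum (2 * N) (-z)‖ ^ 2 =
      2 * (‖partialSum N (z ^ 2)‖ ^ 2 + ‖partialSum N (-z ^ 2)‖ ^ 2) := by
  have h := parallelogram_law_with_norm ℝ (partialSum N (z ^ 2)) (z * partialSum N (-z ^ 2))
  rw [partialSum_two_mul, partialSum_two_mul, neg_sq, neg_mul, ← sub_eq_add_neg]
  rw [norm_mul, hz, one_mul] at h
  linarith

/-- A multiplicative constant `c` and an additive loss `d` propagate along binary digits. -/
theorem norm_sq_partialSum_le (N : ℕ) (hN : 1 ≤ N) :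
    ∀ z : ℂ, ‖z‖ = 1 → ‖partialSum N z‖ ^ 2 + ‖partialSum N (-z)‖ ^ 2 ≤
      ((2 + 2 * √2) * √N - (2 + √2)) ^ 2 := by
  -- Write the bound as c√N - d. Doubling multiplies it by √2 and an odd digit adds √2, so the
  -- induction closes when √2 d - √2 = d, that is d = 2 + √2. Equality at N = 1 requires c - d = √2,
  -- that is c = 2 + 2√2.
  have h2 : √2 ^ 2 = 2 := Real.sq_sqrt (by norm_num)
  have h2p : 0 < √2 := by positivity
  induction N using Nat.strong_induction_on with
  | _ N ih =>
    intro z hz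
    obtain ⟨k, hk⟩ := Nat.even_or_odd' N
    have even_bound : 1 ≤ k → ‖partialSum (2 * k) z‖ ^ 2 + ‖partialSum (2 * k) (-z)‖ ^ 2 ≤
        (√2 * ((2 + 2 * √2) * √k - (2 + √2))) ^ 2 := fun hk1 => by
      rw [norm_sq_partialSum_two_mul k hz, mul_pow, h2]
      exact mul_le_mul_of_nonneg_left (ih k (by omega) hk1 _ (by simp [hz])) two_pos.le
    have hk_nonneg : 1 ≤ k → 0 ≤ (2 + 2 * √2) * √k - (2 + √2) := fun hk1 => by
      have : (1 : ℝ) ≤ √k := Real.one_le_sqrt.2 (by exact_mod_cast hk1)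
      nlinarith
    rcases hk with rfl | rfl
    · have hk1 : 1 ≤ k := by omega
      refine (even_bound hk1).trans (pow_le_pow_left₀ (by have := hk_nonneg hk1; positivity) ?_ 2)
      push_cast
      rw [Real.sqrt_mul zero_le_two]
      nlinarith
    · have step : ∀ w : ℂ, ‖w‖ = 1 → ‖partialSum (2 * k + 1) w‖ ≤ ‖partialSum (2 * k) w‖ + 1 :=
        fun w hw => by
          rw [partialSum_succ]
          refine (norm_add_le _ _).trans_eq ?_
          rw [norm_mul, norm_sign, norm_pow, hw, one_pow, one_mul]
      rcases Nat.eq_zero_or_pos k with rfl | hk1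
      · have h1 := step z hz
        have h3 := step (-z) (by simpa using hz)
        simp only [mul_zero, zero_add, partialSum, Finset.range_zero, Finset.sum_empty,
          norm_zero] at h1 h3 ⊢
        rw [Nat.cast_one, Real.sqrt_one]
        nlinarith [norm_nonneg (∑ k ∈ Finset.range 1, (sign k : ℂ) * z ^ k),
          norm_nonneg (∑ k ∈ Finset.range 1, (sign k : ℂ) * (-z) ^ k)]
      · have h1 := step z hz
        have h3 := step (-z) (by simpa using hz)
        have hb := even_bound hk1
        have hb0 := hk_nonneg hk1
        set u := ‖partialSum (2 * k) z‖
        set v := ‖partialSum (2 * k) (-z)‖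
        set b := √2 * ((2 + 2 * √2) * √k - (2 + √2)) with hbdef
        have hb0' : 0 ≤ b := by positivity
        -- Cauchy–Schwarz; it makes the cross term of (u + 1)² + (v + 1)² fit into (b + √2)².
        have huv : u + v ≤ √2 * b := by
          refine le_of_sq_le_sq ?_ (by positivity)
          rw [mul_pow, h2]
          nlinarith [sq_nonneg (u - v)]
        calc _ ≤ (u + 1) ^ 2 + (v + 1) ^ 2 := by gcongr
          _ ≤ (b + √2) ^ 2 := by nlinarith
          _ ≤ _ := by
            refine pow_le_pow_left₀ (by positivity) ?_ 2
            have hs : √2 * √k ≤ √((2 * k + 1 : ℕ) : ℝ) := by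
              rw [← Real.sqrt_mul zero_le_two]
              exact Real.sqrt_le_sqrt (by push_cast; linarith)
            nlinarith

theorem norm_partialSum_le {N : ℕ} (hN : 1 ≤ N) {z : ℂ} (hz : ‖z‖ = 1) :
    ‖partialSum N z‖ ≤ 5 * √N := by
  have h2 : √2 ^ 2 = 2 := Real.sq_sqrt (by norm_num)
  have h2p : 0 < √2 := by positivity
  have h1 : (1 : ℝ) ≤ √N := Real.one_le_sqrt.2 (by exact_mod_cast hN)
  have h : ‖partialSum N z‖ ≤ (2 + 2 * √2) * √N - (2 + √2) :=
    le_of_sq_le_sq (by nlinarith [norm_sq_partialSum_le N hN z hz, sq_nonneg ‖partialSum N (-z)‖])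
      (by nlinarith)
  nlinarith [Real.sqrt_lt' (x := 2) (y := 3 / 2) (by norm_num) |>.2 (by norm_num)]

end RudinShapiro

/-! ### Odd sine sums: positivity, the parabola series, monotonicity. -/

namespace OddSine

open Finset Filter Topology

theorem sum_sin_mul_sin (K : ℕ) (θ : ℝ) :
    (∑ k ∈ range K, Real.sin ((2 * k + 1) * θ)) * Real.sin θ = Real.sin (K * θ) ^ 2 := by
  induction K with
  | zero => simp
  | succ K ih =>
    rw [sum_range_succ, add_mul, ih]
    push_cast
    rw [show (2 * (K : ℝ) + 1) * θ = K * θ + (K * θ + θ) by ring, add_mul, one_mul,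
      Real.sin_add (K * θ) (K * θ + θ), Real.sin_add (K * θ) θ, Real.cos_add]
    linear_combination (-Real.sin (K * θ) ^ 2 ) * Real.sin_sq_add_cos_sq θ

theorem sum_sin_nonneg (K : ℕ) {θ : ℝ} (h0 : 0 ≤ θ) (hπ : θ ≤ π) :
    0 ≤ ∑ k ∈ range K, Real.sin ((2 * k + 1) * θ) := by
  rcases (Real.sin_nonneg_of_nonneg_of_le_pi h0 hπ).eq_or_lt with h | h
  -- Where sin θ vanishes, θ is a multiple of π and every term is zero.
  · refine sum_nonneg fun k _ => ?_
    rcases Real.sin_eq_zero_iff.1 h.symm with ⟨n, hn⟩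
    refine le_of_eq ?_
    rw [← hn, ← mul_assoc]
    exact_mod_cast (Real.sin_int_mul_pi ((2 * k + 1) * n)).symm
  · have := sum_sin_mul_sin K θ
    nlinarith [sq_nonneg (Real.sin (K * θ))]

/-- Abel summation with antitone nonnegative weights. -/
theorem sum_mul_nonneg_of_antitone {b s : ℕ → ℝ} (hb : Antitone b) (hb0 : ∀ k, 0 ≤ b k)
    (hs : ∀ K, 0 ≤ ∑ k ∈ range K, s k) (K : ℕ) : 0 ≤ ∑ k ∈ range K, b k * s k := by
  -- The induction needs this stronger form, which keeps the last weight as a factor.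
  suffices h : b K * ∑ k ∈ range K, s k ≤ ∑ k ∈ range K, b k * s k from
    (mul_nonneg (hb0 K) (hs K)).trans h
  induction K with
  | zero => simp
  | succ K ih =>
    rw [sum_range_succ (fun k => b k * s k)]
    have h1 := mul_le_mul_of_nonneg_right (hb K.le_succ) (hs (K + 1))
    rw [sum_range_succ] at h1 ⊢
    simp only [Nat.succ_eq_add_one] at h1
    linarith

theorem sum_mul_sin_nonneg {b : ℕ → ℝ} (hb : Antitone b) (hb0 : ∀ k, 0 ≤ b k) (K : ℕ) {θ : ℝ}
    (h0 : 0 ≤ θ) (hπ : θ ≤ π) : 0 ≤ ∑ k ∈ range K, b k * Real.sin ((2 * k + 1) * θ) :=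
  sum_mul_nonneg_of_antitone hb hb0 (fun K => sum_sin_nonneg K h0 hπ) K

theorem sin_odd_mul_add_pi_div_two (k : ℕ) (φ : ℝ) :
    Real.sin ((2 * k + 1) * (π / 2 + φ)) = (-1) ^ k * Real.cos ((2 * k + 1) * φ) := by
  rw [show (2 * (k : ℝ) + 1) * (π / 2 + φ) = ((2 * k + 1) * φ + π / 2) + k * π by ring,
    Real.sin_add_nat_mul_pi, Real.sin_add_pi_div_two]

/-- The full series over all n is a cubic Bernoulli polynomial; its even terms are 1/8 of the same
series at 2θ, and removing them leaves the odd ones. -/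
theorem hasSum_sin_div_cube {θ : ℝ} (h0 : 0 ≤ θ) (hπ : θ ≤ π) :
    HasSum (fun k : ℕ => Real.sin ((2 * k + 1) * θ) / (2 * k + 1) ^ 3) (π * θ * (π - θ) / 8) := by
  have hp := Real.pi_pos
  have key : ∀ y : ℝ, 0 ≤ y → y ≤ 2 * π →
      HasSum (fun n : ℕ => Real.sin (n * y) / (n : ℝ) ^ 3)
        (π ^ 2 * y / 6 - π * y ^ 2 / 4 + y ^ 3 / 12) := fun y hy0 hy1 => by
    have h := hasSum_one_div_nat_pow_mul_sin one_ne_zero (x := y / (2 * π))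
      ⟨by positivity, by rw [div_le_one (by positivity)]; exact hy1⟩
    convert h using 1
    · funext n
      rw [show 2 * π * n * (y / (2 * π)) = n * y by field_simp]
      ring
    · rw [Polynomial.eval_map_algebraMap, show 2 * 1 + 1 = 3 from rfl, Polynomial.bernoulli_def]
      simp [sum_range_succ, bernoulli_one, bernoulli_two,
        bernoulli_eq_zero_of_odd (n := 3) (by decide) (by norm_num), Nat.choose, Nat.factorial,
        ← Polynomial.C_mul_X_pow_eq_monomial, map_ofNat]
      field_simp
      ring
  have h1 := key θ h0 (by linarith)
  have h2 := (key (2 * θ) (by linarith) (by linarith)).div_const 8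
  have he : HasSum (fun n : ℕ => if Even n then Real.sin (n * θ) / (n : ℝ) ^ 3 else 0)
      ((π ^ 2 * (2 * θ) / 6 - π * (2 * θ) ^ 2 / 4 + (2 * θ) ^ 3 / 12) / 8) := by
    rw [← (mul_right_injective₀ (two_ne_zero' ℕ)).hasSum_iff]
    · refine (congrArg (HasSum · _) (funext fun n => ?_)).mpr h2
      simp only [Function.comp, even_two, Even.mul_right, if_true]
      push_cast
      rw [show (n : ℝ) * (2 * θ) = 2 * n * θ by ring, mul_pow, div_div, mul_comm ((n : ℝ) ^ 3)]
      norm_num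
    · rintro n hn
      rw [if_neg]
      rintro ⟨m, rfl⟩
      exact hn ⟨m, by simp only; ring⟩
  have hinj : Function.Injective fun k : ℕ => 2 * k + 1 := fun a b h => by
    simp only at h; omega
  have h3 := (hinj.hasSum_iff (f := fun n : ℕ => Real.sin (n * θ) / (n : ℝ) ^ 3 -
    if Even n then Real.sin (n * θ) / (n : ℝ) ^ 3 else 0) ?_).2 (h1.sub he)
  · convert h3 using 1
    · funext k
      simp only [Function.comp]
      rw [if_neg (by simp), sub_zero]
      push_cast
      rfl
    · ring
  · intro n hn
    rw [if_pos, sub_self]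
    rw [← Nat.not_odd_iff_even]
    rintro ⟨m, rfl⟩
    exact hn ⟨m, rfl⟩

/-- Bernoulli's inequality for the power `t` of e^{-s}. For s > 0 it says that (1 - e^{-s}) / s
decreases, which makes the Abel weights antitone. -/
theorem one_sub_exp_neg_mul_le {s t : ℝ} (ht : 1 ≤ t) :
    1 - Real.exp (-(t * s)) ≤ t * (1 - Real.exp (-s)) := by
  have h := one_add_mul_self_le_rpow_one_add (s := Real.exp (-s) - 1) (p := t)
    (by linarith [Real.exp_pos (-s)]) ht
  rw [add_sub_cancel, ← Real.exp_mul, show -s * t = -(t * s) by ring] at h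
  linarith

/-- Equality holds at s = 0, and comparing derivatives in s reduces to `one_sub_exp_neg_mul_le`. -/
theorem exp_neg_remainder_mul_le {s t : ℝ} (hs : 0 ≤ s) (ht : 1 ≤ t) :
    t * s - 1 + Real.exp (-(t * s)) ≤ t ^ 2 * (s - 1 + Real.exp (-s)) := by
  have hd : ∀ u : ℝ, HasDerivAt (fun u : ℝ => t ^ 2 * (u - 1 + Real.exp (-u)) -
      (t * u - 1 + Real.exp (-(t * u))))
      (t ^ 2 * (1 - Real.exp (-u)) - t * (1 - Real.exp (-(t * u)))) u := fun u => by
    have h1 := ((hasDerivAt_id u).sub_const 1).add (hasDerivAt_neg u).exp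
    have h2 := (((hasDerivAt_id u).const_mul t).sub_const 1).add
      ((hasDerivAt_id u).const_mul t).neg.exp
    refine ((h1.const_mul (t ^ 2)).sub h2).congr_deriv ?_
    change t ^ 2 * (1 + Real.exp (-u) * -1) - (t * 1 + Real.exp (-(t * u)) * -(t * 1)) = _
    ring
  have hmono : MonotoneOn (fun u : ℝ => t ^ 2 * (u - 1 + Real.exp (-u)) -
      (t * u - 1 + Real.exp (-(t * u)))) (Set.Ici 0) := by
    refine monotoneOn_of_deriv_nonneg (convex_Ici 0) (fun u _ => (hd u).continuousAt.continuousWithinAt)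
      (fun u _ => (hd u).differentiableAt.differentiableWithinAt) fun u hu => ?_
    rw [(hd u).deriv]
    rw [interior_Ici] at hu
    have := one_sub_exp_neg_mul_le (s := u) ht
    nlinarith
  have h := hmono Set.self_mem_Ici hs hs
  simp only [mul_zero, neg_zero, Real.exp_zero, zero_sub, neg_add_cancel, sub_self] at h
  linarith

/-- The harmonic majorant of the parabola decreases along the strip. -/
theorem sum_exp_mul_sin_le {x θ : ℝ} (hx : 0 ≤ x) (h0 : 0 ≤ θ) (hπ : θ ≤ π) (K : ℕ) :
    ∑ k ∈ range K, Real.exp (-((2 * k + 1) * x)) * Real.sin ((2 * k + 1) * θ) / (2 * k + 1) ^ 3 ≤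
      ∑ k ∈ range K, Real.sin ((2 * k + 1) * θ) / (2 * k + 1) ^ 3 := by
  have h := sum_mul_sin_nonneg
    (b := fun k : ℕ => (1 - Real.exp (-((2 * k + 1) * x))) / (2 * k + 1) ^ 3) ?_ ?_ K h0 hπ
  · rw [← sub_nonneg, ← sum_sub_distrib]
    refine h.trans_eq (sum_congr rfl fun k _ => ?_)
    ring
  · refine antitone_nat_of_succ_le fun k => ?_
    have hm : (0 : ℝ) < 2 * k + 1 := by positivity
    set m : ℝ := 2 * k + 1 with hmd
    have hc : (2 * ((k + 1 : ℕ) : ℝ) + 1) = m + 2 := by push_cast; ring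
    rw [hc]
    have ht : 1 ≤ (m + 2) / m := by rw [le_div_iff₀ hm]; linarith
    have h1 := one_sub_exp_neg_mul_le (s := m * x) ht
    rw [show (m + 2) / m * (m * x) = (m + 2) * x by field_simp] at h1
    have he : 0 ≤ 1 - Real.exp (-(m * x)) := by
      rw [sub_nonneg, Real.exp_le_one_iff]; have := mul_nonneg hm.le hx; linarith
    calc _ ≤ ((m + 2) / m * (1 - Real.exp (-(m * x)))) / (m + 2) ^ 3 := by gcongr
      _ = (1 - Real.exp (-(m * x))) / (m * (m + 2) ^ 2) := by field_simp
      _ ≤ _ := by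
        gcongr
        nlinarith
  · intro k
    have : 0 ≤ 1 - Real.exp (-((2 * k + 1) * x)) := by
      rw [sub_nonneg, Real.exp_le_one_iff]
      have : 0 ≤ (2 * (k : ℝ) + 1) * x := by positivity
      linarith
    positivity

/-- An alternating form of e^{-s} ≥ 1 - s: at θ = π/2 the odd sines are the signs (-1)^k. It
linearises the majorant at F(0). -/
theorem sum_exp_remainder_nonneg {x : ℝ} (hx : 0 ≤ x) (K : ℕ) :
    0 ≤ ∑ k ∈ range K, (-1 : ℝ) ^ k *
      ((2 * k + 1) * x - 1 + Real.exp (-((2 * k + 1) * x))) / (2 * k + 1) ^ 3 := by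
  have h := sum_mul_sin_nonneg
    (b := fun k : ℕ => ((2 * k + 1) * x - 1 + Real.exp (-((2 * k + 1) * x))) / (2 * k + 1) ^ 3)
    ?_ ?_ K (θ := π / 2) (by positivity) (by linarith [Real.pi_pos])
  · refine h.trans_eq (sum_congr rfl fun k _ => ?_)
    have := sin_odd_mul_add_pi_div_two k 0
    rw [add_zero, mul_zero, Real.cos_zero, mul_one] at this
    rw [this]
    ring
  · refine antitone_nat_of_succ_le fun k => ?_
    have hm : (0 : ℝ) < 2 * k + 1 := by positivity
    set m : ℝ := 2 * k + 1 with hmd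
    have hc : (2 * ((k + 1 : ℕ) : ℝ) + 1) = m + 2 := by push_cast; ring
    rw [hc]
    have ht : 1 ≤ (m + 2) / m := by rw [le_div_iff₀ hm]; linarith
    have h1 := exp_neg_remainder_mul_le (mul_nonneg hm.le hx) ht
    rw [show (m + 2) / m * (m * x) = (m + 2) * x by field_simp] at h1
    have he : 0 ≤ m * x - 1 + Real.exp (-(m * x)) := by
      linarith [Real.add_one_le_exp (-(m * x))]
    calc _ ≤ (((m + 2) / m) ^ 2 * (m * x - 1 + Real.exp (-(m * x)))) / (m + 2) ^ 3 := by gcongr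
      _ = (m * x - 1 + Real.exp (-(m * x))) / (m ^ 2 * (m + 2)) := by field_simp
      _ ≤ _ := by
        gcongr
        nlinarith [sq_nonneg m]
  · intro k
    have : 0 ≤ (2 * (k : ℝ) + 1) * x - 1 + Real.exp (-((2 * k + 1) * x)) := by
      linarith [Real.add_one_le_exp (-((2 * (k : ℝ) + 1) * x))]
    positivity

theorem summable_one_div_odd_cube : Summable fun k : ℕ => 1 / (2 * (k : ℝ) + 1) ^ 3 := by
  have h := (Real.summable_one_div_nat_pow (p := 3)).2 (by norm_num)
  have h2 := h.comp_injective (i := fun k : ℕ => 2 * k + 1) fun a b h => by simp only at h; omega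
  refine h2.congr fun k => ?_
  simp

end OddSine

/-! ### Mean-square bound for maps into the half-strip. -/

namespace TrigPoly

open Finset Filter Topology

theorem circleAverage_const_mul (a : ℝ) (f : ℂ → ℝ) :
    Real.circleAverage (fun z => a * f z) 0 1 = a * Real.circleAverage f 0 1 :=
  Real.circleAverage_fun_smul (a := a) (f := f)

theorem circleAverage_re_of_differentiable {F : ℂ → ℂ} (hF : Differentiable ℂ F) :
    Real.circleAverage (fun z => (F z).re) 0 1 = (F 0).re := by
  have h := Complex.reCLM.circleAverage_comp_comm (f := F) (c := 0) (R := 1)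
    hF.continuous.continuousOn.circleIntegrable'
  rw [hF.diffContOnCl.circleAverage] at h
  exact h

theorem hasSum_catalanConst :
    HasSum (fun k : ℕ => (-1 : ℝ) ^ k / (2 * (k : ℝ) + 1) ^ 2) catalanConst :=
  summable_catalan.hasSum

/-- The finite-sum form of the majorant of `φ ^ 2` on the half-strip. -/
theorem sq_add_sum_le {x φ : ℝ} (hx : 0 ≤ x) (hφ : |φ| ≤ π / 2) (K : ℕ) :
    φ ^ 2 + 8 / π * ∑ k ∈ range K, (-1) ^ k / (2 * k + 1) ^ 3 *
        (Real.exp (-((2 * k + 1) * x)) * Real.cos ((2 * k + 1) * φ)) ≤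
      π ^ 2 / 4 + 8 / π * ∑' k : ℕ, 1 / (2 * ((k + K : ℕ) : ℝ) + 1) ^ 3 := by
  have hp := Real.pi_pos
  rw [abs_le] at hφ
  have h0 : 0 ≤ π / 2 + φ := by linarith
  have h1 : π / 2 + φ ≤ π := by linarith
  have hs := OddSine.hasSum_sin_div_cube h0 h1
  have hsum := hs.summable.sum_add_tsum_nat_add K
  -- Truncating at `K` costs at most this tail, so only finite sums have to be averaged later.
  have htail : -∑' k : ℕ, 1 / (2 * ((k + K : ℕ) : ℝ) + 1) ^ 3 ≤
      ∑' k : ℕ, Real.sin ((2 * ((k + K : ℕ) : ℝ) + 1) * (π / 2 + φ)) /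
        (2 * ((k + K : ℕ) : ℝ) + 1) ^ 3 := by
    rw [← tsum_neg]
    refine Summable.tsum_le_tsum (fun k => ?_)
      ((summable_nat_add_iff K).2 OddSine.summable_one_div_odd_cube).neg
      ((summable_nat_add_iff K).2 hs.summable)
    rw [← neg_div]
    gcongr
    exact Real.neg_one_le_sin _
  have hle := OddSine.sum_exp_mul_sin_le hx h0 h1 K
  have heq : ∑ k ∈ range K, Real.exp (-((2 * k + 1) * x)) *
      Real.sin ((2 * k + 1) * (π / 2 + φ)) / (2 * k + 1) ^ 3 =
      ∑ k ∈ range K, (-1) ^ k / (2 * k + 1) ^ 3 *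
        (Real.exp (-((2 * k + 1) * x)) * Real.cos ((2 * k + 1) * φ)) :=
    sum_congr rfl fun k _ => by rw [OddSine.sin_odd_mul_add_pi_div_two]; ring
  rw [heq] at hle
  rw [hs.tsum_eq] at hsum
  have hfin : ∑ k ∈ range K, (-1) ^ k / (2 * (k : ℝ) + 1) ^ 3 *
        (Real.exp (-((2 * k + 1) * x)) * Real.cos ((2 * k + 1) * φ)) ≤
      π * (π / 2 + φ) * (π - (π / 2 + φ)) / 8 +
        ∑' k : ℕ, 1 / (2 * ((k + K : ℕ) : ℝ) + 1) ^ 3 := by linarith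
  have h8 := mul_le_mul_of_nonneg_left hfin (by positivity : 0 ≤ 8 / π)
  have : 8 / π * (π * (π / 2 + φ) * (π - (π / 2 + φ)) / 8) = π ^ 2 / 4 - φ ^ 2 := by
    field_simp; ring
  linarith

/-- An analytic map of the disc into a half-strip has small imaginary part in mean square. -/
theorem circleAverage_im_sq_le {F : ℂ → ℂ} (hF : Differentiable ℂ F) {h : ℝ} (hF0 : F 0 = h)
    (hre : ∀ z, ‖z‖ = 1 → 0 ≤ (F z).re) (him : ∀ z, ‖z‖ = 1 → |(F z).im| ≤ π / 2) :
    Real.circleAverage (fun z => (F z).im ^ 2) 0 1 ≤ 8 / π * catalanConst * h := by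
  have hp := Real.pi_pos
  have hh : 0 ≤ h := by
    have h1 := circleAverage_re_of_differentiable hF
    rw [hF0, Complex.ofReal_re] at h1
    rw [← h1]
    refine Real.circleAverage_nonneg_of_nonneg fun z hz => hre z ?_
    simpa using hz
  have hint : ∀ g : ℂ → ℝ, Continuous g → CircleIntegrable g 0 1 := fun g hg =>
    hg.continuousOn.circleIntegrable'
  have hFc := hF.continuous
  -- Each term of the majorant composed with F is the real part of the entire function e^{-(2k+1)F}.
  have hmean : ∀ k : ℕ, Real.circleAverage (fun z => Real.exp (-((2 * k + 1) * (F z).re)) *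
      Real.cos ((2 * k + 1) * (F z).im)) 0 1 = Real.exp (-((2 * k + 1) * h)) := fun k => by
    have hd : Differentiable ℂ fun z => Complex.exp (-(((2 * k + 1 : ℝ) : ℂ) * F z)) := by fun_prop
    have h1 := circleAverage_re_of_differentiable hd
    simpa only [Complex.exp_re, Complex.neg_re, Complex.neg_im, Complex.re_ofReal_mul,
      Complex.im_ofReal_mul, Real.cos_neg, hF0, Complex.ofReal_re, Complex.ofReal_im, mul_zero,
      Real.cos_zero, mul_one] using h1
  have hK : ∀ K : ℕ, Real.circleAverage (fun z => (F z).im ^ 2) 0 1 ≤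
      π ^ 2 / 4 + 8 / π * ∑' k : ℕ, 1 / (2 * ((k + K : ℕ) : ℝ) + 1) ^ 3 -
        8 / π * ∑ k ∈ range K, (-1) ^ k / (2 * (k : ℝ) + 1) ^ 3 +
        8 / π * (∑ k ∈ range K, (-1) ^ k / (2 * (k : ℝ) + 1) ^ 2) * h := fun K => by
    have hcont : ∀ k : ℕ, Continuous fun z => (-1) ^ k / (2 * (k : ℝ) + 1) ^ 3 *
        (Real.exp (-((2 * k + 1) * (F z).re)) * Real.cos ((2 * k + 1) * (F z).im)) :=
      fun k => by fun_prop
    have h1 : Real.circleAverage (fun z => (F z).im ^ 2 + 8 / π * ∑ k ∈ range K,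
        (-1) ^ k / (2 * (k : ℝ) + 1) ^ 3 *
        (Real.exp (-((2 * k + 1) * (F z).re)) * Real.cos ((2 * k + 1) * (F z).im))) 0 1 ≤
        π ^ 2 / 4 + 8 / π * ∑' k : ℕ, 1 / (2 * ((k + K : ℕ) : ℝ) + 1) ^ 3 := by
      refine Real.circleAverage_mono_on_of_le_circle (hint _ (by fun_prop)) fun z hz => ?_
      have hz : ‖z‖ = 1 := by simpa using hz
      exact sq_add_sum_le (hre z hz) (him z hz) K
    rw [Real.circleAverage_fun_add (hint _ (by fun_prop)) (hint _ (by fun_prop))] at h1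
    rw [circleAverage_const_mul, Real.circleAverage_fun_sum fun k _ => hint _ (hcont k)] at h1
    have h3 : ∀ k : ℕ, Real.circleAverage (fun z => (-1) ^ k / (2 * (k : ℝ) + 1) ^ 3 *
        (Real.exp (-((2 * k + 1) * (F z).re)) * Real.cos ((2 * k + 1) * (F z).im))) 0 1 =
        (-1) ^ k / (2 * (k : ℝ) + 1) ^ 3 * Real.exp (-((2 * k + 1) * h)) := fun k => by
      rw [← hmean k]
      exact circleAverage_const_mul _ _
    rw [sum_congr rfl fun k _ => h3 k] at h1
    have h4 := OddSine.sum_exp_remainder_nonneg hh K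
    have h5 : ∑ k ∈ range K, (-1 : ℝ) ^ k *
        ((2 * k + 1) * h - 1 + Real.exp (-((2 * k + 1) * h))) / (2 * k + 1) ^ 3 =
        (∑ k ∈ range K, (-1) ^ k / (2 * (k : ℝ) + 1) ^ 2) * h -
        (∑ k ∈ range K, (-1) ^ k / (2 * (k : ℝ) + 1) ^ 3) +
        ∑ k ∈ range K, (-1) ^ k / (2 * (k : ℝ) + 1) ^ 3 * Real.exp (-((2 * k + 1) * h)) := by
      rw [sum_mul, ← sum_sub_distrib, ← sum_add_distrib]
      refine sum_congr rfl fun k _ => ?_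
      have : (2 * (k : ℝ) + 1) ≠ 0 := by positivity
      field_simp
    rw [h5] at h4
    have h6 := mul_nonneg (by positivity : 0 ≤ 8 / π) h4
    linarith
  refine ge_of_tendsto' (x := atTop) ?_ hK
  have t1 := tendsto_sum_nat_add fun k : ℕ => 1 / (2 * (k : ℝ) + 1) ^ 3
  -- In the limit (8/π)(π³/32) cancels π²/4, leaving only the term with Catalan's constant.
  have hcube : HasSum (fun k : ℕ => (-1 : ℝ) ^ k / (2 * (k : ℝ) + 1) ^ 3) (π ^ 3 / 32) := by
    have h1 := OddSine.hasSum_sin_div_cube (θ := π / 2) (by positivity) (by linarith)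
    have h2 : ∀ k : ℕ, Real.sin ((2 * k + 1) * (π / 2)) = (-1) ^ k := fun k => by
      have := OddSine.sin_odd_mul_add_pi_div_two k 0
      rwa [add_zero, mul_zero, Real.cos_zero, mul_one] at this
    simp only [h2] at h1
    rwa [show π * (π / 2) * (π - π / 2) / 8 = π ^ 3 / 32 by ring] at h1
  have t := (((t1.const_mul (8 / π)).const_add (π ^ 2 / 4)).sub
    (hcube.tendsto_sum_nat.const_mul (8 / π))).add
    ((hasSum_catalanConst.tendsto_sum_nat.const_mul (8 / π)).mul_const h)
  convert t using 2
  field_simp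
  ring

end TrigPoly

/-! ### The integral A_2 and Catalan's constant. -/

namespace TrigPoly

open Finset Filter Topology MeasureTheory

theorem sin_half_pi_mul_pos {t : ℝ} (ht : t ∈ Set.Ioc (0 : ℝ) 1) : 0 < Real.sin (π * t / 2) :=
  Real.sin_pos_of_pos_of_lt_pi (by have := ht.1; positivity) (by nlinarith [ht.2, Real.pi_pos])

theorem intervalIntegrable_div_sin :
    IntervalIntegrable (fun t : ℝ => t / Real.sin (π * t / 2)) volume 0 1 := by
  rw [intervalIntegrable_iff_integrableOn_Ioc_of_le zero_le_one]
  refine Measure.integrableOn_of_bounded (M := 1) (by simp)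
    (Measurable.aestronglyMeasurable (by fun_prop)) ?_
  refine (ae_restrict_mem measurableSet_Ioc).mono fun t ht => ?_
  have hs := sin_half_pi_mul_pos ht
  rw [Real.norm_of_nonneg (div_nonneg ht.1.le hs.le), div_le_one hs]
  have h := Real.mul_le_sin (x := π * t / 2) (by have := ht.1; positivity)
    (by nlinarith [ht.2, Real.pi_pos])
  rwa [show 2 / π * (π * t / 2) = t by field_simp] at h

theorem tendsto_integral_cos_mul {g : ℝ → ℝ} (hg : IntervalIntegrable g volume 0 1) :
    Tendsto (fun K : ℕ => ∫ t in (0 : ℝ)..1, Real.cos (K * (π * t)) * g t) atTop (𝓝 0) := by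
  rw [intervalIntegrable_iff_integrableOn_Ioc_of_le zero_le_one] at hg
  set f : ℝ → ℂ := fun t => (((Set.Ioc (0 : ℝ) 1).indicator g t : ℝ) : ℂ) with hf
  have hfi : Integrable f := ((integrable_indicator_iff measurableSet_Ioc).2 hg).ofReal
  -- Riemann–Lebesgue at frequency K/2: the Fourier character carries a factor 2π, which yields
  -- cos(Kπt).
  have hlim := (Real.tendsto_integral_exp_smul_cocompact f).comp
    ((tendsto_natCast_atTop_atTop (R := ℝ)).atTop_div_const two_pos |>.mono_right
      atTop_le_cocompact)
  have hre := (Complex.continuous_re.tendsto 0).comp hlim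
  rw [Complex.zero_re] at hre
  refine hre.congr fun K => ?_
  simp only [Function.comp]
  have hint : Integrable fun v : ℝ => Real.fourierChar (-(v * ((K : ℝ) / 2))) • f v := by
    refine hfi.mono ?_ (Eventually.of_forall fun v => (Circle.norm_smul _ _).le)
    exact (by fun_prop : Continuous fun v : ℝ => Real.fourierChar (-(v * ((K : ℝ) / 2)))
      ).aestronglyMeasurable.smul hfi.aestronglyMeasurable
  have h1 := Complex.reCLM.integral_comp_comm hint
  simp only [Complex.reCLM_apply] at h1
  rw [← h1, intervalIntegral.integral_of_le zero_le_one, ← integral_indicator measurableSet_Ioc]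
  congr 1
  funext v
  rw [Circle.smul_def, Real.fourierChar_apply, smul_eq_mul, hf, Complex.re_mul_ofReal]
  by_cases hv : v ∈ Set.Ioc (0 : ℝ) 1
  · rw [Set.indicator_of_mem hv, Set.indicator_of_mem hv, Complex.exp_ofReal_mul_I_re,
      ← Real.cos_neg]
    congr 2
    ring
  · rw [Set.indicator_of_notMem hv, Set.indicator_of_notMem hv, mul_zero]

theorem integral_mul_sin_odd (k : ℕ) :
    ∫ t in (0 : ℝ)..1, t * Real.sin ((2 * k + 1) * (π * t / 2)) =
      4 / π ^ 2 * ((-1) ^ k / (2 * k + 1) ^ 2) := by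
  have hp := Real.pi_pos
  set m : ℝ := 2 * k + 1 with hm
  have hm0 : 0 < m := by positivity
  have hd : ∀ t ∈ Set.uIcc (0 : ℝ) 1, HasDerivAt (fun t : ℝ =>
      4 / (π ^ 2 * m ^ 2) * Real.sin (m * (π * t / 2)) -
        2 / (π * m) * (t * Real.cos (m * (π * t / 2))))
      (t * Real.sin (m * (π * t / 2))) t := fun t _ => by
    have hl : HasDerivAt (fun t : ℝ => m * (π * t / 2)) (m * (π * 1 / 2)) t :=
      (((hasDerivAt_id t).const_mul π).div_const 2).const_mul m
    refine ((hl.sin.const_mul _).sub (((hasDerivAt_id t).mul hl.cos).const_mul _)).congr_deriv ?_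
    simp only [id_eq]
    field_simp
    ring
  rw [intervalIntegral.integral_eq_sub_of_hasDerivAt hd
    ((by fun_prop : Continuous fun t : ℝ => t * Real.sin (m * (π * t / 2))).intervalIntegrable _ _)]
  have h1 : Real.sin (m * (π * 1 / 2)) = (-1) ^ k := by
    have := OddSine.sin_odd_mul_add_pi_div_two k 0
    rw [add_zero, mul_zero, Real.cos_zero, mul_one] at this
    rw [← this, mul_one]
  have h2 : Real.cos (m * (π * 1 / 2)) = 0 := by
    rw [show m * (π * 1 / 2) = k * π + π / 2 by rw [hm]; ring, Real.cos_add_pi_div_two,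
      Real.sin_nat_mul_pi, neg_zero]
  rw [h1, h2]
  simp
  field_simp

/-- Summing `integral_mul_sin_odd` gives the partial sums of Catalan's series; the closed form (1 -
cos(Kπt)) / (2 sin(πt/2)) of the sine sum splits off an oscillating integral that tends to 0. -/
theorem integral_div_sin :
    ∫ t in (0 : ℝ)..1, t / Real.sin (π * t / 2) = 8 * catalanConst / π ^ 2 := by
  have hp := Real.pi_pos
  set g : ℝ → ℝ := fun t => t / Real.sin (π * t / 2) with hg
  have hgi : IntervalIntegrable g volume 0 1 := intervalIntegrable_div_sin
  have hK : ∀ K : ℕ, 4 / π ^ 2 * ∑ k ∈ range K, (-1 : ℝ) ^ k / (2 * k + 1) ^ 2 =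
      1 / 2 * ((∫ t in (0 : ℝ)..1, g t) -
        ∫ t in (0 : ℝ)..1, Real.cos (K * (π * t)) * g t) := fun K => by
    rw [← intervalIntegral.integral_sub hgi (hgi.continuousOn_mul (by fun_prop)),
      ← intervalIntegral.integral_const_mul, mul_sum,
      ← sum_congr rfl fun k _ => integral_mul_sin_odd k,
      ← intervalIntegral.integral_finsetSum
        (f := fun (k : ℕ) (t : ℝ) => t * Real.sin ((2 * k + 1) * (π * t / 2)))
        fun k _ => (by fun_prop : Continuous fun t : ℝ =>
          t * Real.sin ((2 * k + 1) * (π * t / 2))).intervalIntegrable _ _]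
    refine intervalIntegral.integral_congr_ae (Eventually.of_forall fun t ht => ?_)
    rw [Set.uIoc_of_le zero_le_one] at ht
    have hs := sin_half_pi_mul_pos ht
    have h1 := OddSine.sum_sin_mul_sin K (π * t / 2)
    rw [← mul_sum, eq_div_of_mul_eq hs.ne' h1, Real.sin_sq_eq_half_sub, hg,
      show 2 * ((K : ℝ) * (π * t / 2)) = K * (π * t) by ring]
    field_simp
  have t1 := hasSum_catalanConst.tendsto_sum_nat.const_mul (4 / π ^ 2)
  have t2 := ((tendsto_integral_cos_mul hgi).const_sub (∫ t in (0 : ℝ)..1, g t)).const_mul (1 / 2)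
  have := tendsto_nhds_unique t1 (t2.congr fun K => (hK K).symm)
  rw [sub_zero] at this
  have h8 : 8 * catalanConst / π ^ 2 = 2 * (4 / π ^ 2 * catalanConst) := by ring
  rw [h8, this]
  ring

end TrigPoly

/-! ### Mean squares on the circle and the two bounds for M. -/

namespace TrigPoly

open Finset Filter Topology MeasureTheory ComplexConjugate

/-- On the circle conj z inverts z, so for l ≤ m the integrand is the real part of a polynomial with
a known value at 0; conjugation covers the other case. -/
theorem circleAverage_re_pow_mul_conj_pow (c : ℂ) (m l : ℕ) :
    Real.circleAverage (fun z => (c * (z ^ m * conj z ^ l)).re) 0 1 =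
      if m = l then c.re else 0 := by
  have key : ∀ (c : ℂ) (m l : ℕ), l ≤ m →
      Real.circleAverage (fun z => (c * (z ^ m * conj z ^ l)).re) 0 1 =
        if m = l then c.re else 0 := fun c m l hml => by
    have h : Real.circleAverage (fun z => (c * (z ^ m * conj z ^ l)).re) 0 1 =
        Real.circleAverage (fun z => (c * z ^ (m - l)).re) 0 1 := by
      refine Real.circleAverage_congr_sphere fun z hz => ?_
      have hz : ‖z‖ = 1 := by simpa using hz
      have hzz : z * conj z = 1 := by rw [Complex.mul_conj', hz]; simp
      obtain ⟨d, rfl⟩ := Nat.exists_eq_add_of_le hml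
      simp only [Nat.add_sub_cancel_left]
      rw [pow_add, mul_comm (z ^ l), mul_assoc (z ^ d), ← mul_pow, hzz, one_pow, mul_one]
    rw [h, circleAverage_re_of_differentiable (F := fun z => c * z ^ (m - l)) (by fun_prop)]
    split_ifs with hm
    · simp [hm]
    · rw [zero_pow (by omega), mul_zero, Complex.zero_re]
  rcases le_total l m with h | h
  · exact key c m l h
  · have h1 := key (conj c) l m h
    rw [Complex.conj_re] at h1
    simp only [eq_comm (a := l)] at h1
    rw [← h1]
    congr 1
    funext z
    rw [← Complex.conj_re]
    simp only [map_mul, map_pow, Complex.conj_conj]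
    rw [mul_comm (conj z ^ m)]

theorem circleAverage_norm_sq_sum {N : ℕ} {n : Fin N → ℕ} (hn : Function.Injective n)
    (a : Fin N → ℂ) :
    Real.circleAverage (fun z => ‖∑ k, a k * z ^ n k‖ ^ 2) 0 1 = ∑ k, ‖a k‖ ^ 2 := by
  have h : (fun z : ℂ => ‖∑ k, a k * z ^ n k‖ ^ 2) =
      fun z => ∑ k, ∑ l, (a k * conj (a l) * (z ^ n k * conj z ^ n l)).re := by
    funext z
    have h1 : ‖∑ k, a k * z ^ n k‖ ^ 2 =
        ((∑ k, a k * z ^ n k) * conj (∑ k, a k * z ^ n k)).re := by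
      rw [Complex.mul_conj']
      exact_mod_cast (Complex.ofReal_re _).symm
    rw [h1, map_sum, sum_mul_sum, Complex.re_sum]
    refine sum_congr rfl fun k _ => ?_
    rw [Complex.re_sum]
    refine sum_congr rfl fun l _ => ?_
    rw [map_mul, map_pow, mul_mul_mul_comm]
  have hcont : ∀ k l, Continuous fun z : ℂ =>
      (a k * conj (a l) * (z ^ n k * conj z ^ n l)).re := fun k l => by fun_prop
  rw [h, Real.circleAverage_fun_sum fun k _ =>
    (continuous_finsetSum _ fun l _ => hcont k l).continuousOn.circleIntegrable']
  refine sum_congr rfl fun k _ => ?_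
  rw [Real.circleAverage_fun_sum fun l _ => (hcont k l).continuousOn.circleIntegrable']
  simp only [circleAverage_re_pow_mul_conj_pow, hn.eq_iff, sum_ite_eq, mem_univ, if_true]
  rw [Complex.mul_conj']
  exact_mod_cast Complex.ofReal_re _

/-- From |P|² = Re(P²) + 2(Im P)²: the mean of Re(P²) is its value at 0, which is zero since all
frequencies are positive. -/
theorem circleAverage_im_sq_sum {N : ℕ} {n : Fin N → ℕ} (hpos : ∀ k, 0 < n k)
    (hn : Function.Injective n) (a : Fin N → ℂ) :
    Real.circleAverage (fun z => (∑ k, a k * z ^ n k).im ^ 2) 0 1 = (∑ k, ‖a k‖ ^ 2) / 2 := by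
  have h0 : ∑ k, a k * (0 : ℂ) ^ n k = 0 :=
    sum_eq_zero fun k _ => by rw [zero_pow (hpos k).ne', mul_zero]
  have h1 := circleAverage_re_of_differentiable (F := fun z => (∑ k, a k * z ^ n k) ^ 2)
    (by fun_prop)
  rw [h0, zero_pow two_ne_zero, Complex.zero_re] at h1
  have h2 : (fun z : ℂ => ‖∑ k, a k * z ^ n k‖ ^ 2) = fun z =>
      ((∑ k, a k * z ^ n k) ^ 2).re + 2 * (∑ k, a k * z ^ n k).im ^ 2 := by
    funext z
    rw [Complex.sq_norm, Complex.normSq_apply, sq (∑ k, a k * z ^ n k), Complex.mul_re]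
    ring
  have h3 := circleAverage_norm_sq_sum hn a
  rw [h2, Real.circleAverage_fun_add
    (by fun_prop : Continuous fun z : ℂ => ((∑ k, a k * z ^ n k) ^ 2).re
      ).continuousOn.circleIntegrable'
    (by fun_prop : Continuous fun z : ℂ => 2 * (∑ k, a k * z ^ n k).im ^ 2
      ).continuousOn.circleIntegrable', h1, circleAverage_const_mul] at h3
  linarith

theorem exists_poly_eq {N : ℕ} (n : Fin N → ℕ) (a : Fin N → ℂ) {z : ℂ} (hz : ‖z‖ = 1) :
    ∃ x : Torus, poly n a x = ∑ k, a k * z ^ n k := by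
  refine ⟨(z.arg : ℝ), ?_⟩
  rw [poly_coe]
  refine sum_congr rfl fun k _ => ?_
  have h := Complex.norm_mul_exp_arg_mul_I z
  rw [hz, Complex.ofReal_one, one_mul] at h
  conv_rhs => rw [← h]
  rw [← Complex.exp_nat_mul]
  congr 2
  ring

theorem exists_norm_one_poly_eq {N : ℕ} (n : Fin N → ℕ) (a : Fin N → ℂ) (x : Torus) :
    ∃ z : ℂ, ‖z‖ = 1 ∧ poly n a x = ∑ k, a k * z ^ n k := by
  induction x using QuotientAddGroup.induction_on with
  | H x =>
    refine ⟨Complex.exp (x * Complex.I), Complex.norm_exp_ofReal_mul_I x, ?_⟩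
    refine (poly_coe n a x).trans (sum_congr rfl fun k _ => ?_)
    rw [← Complex.exp_nat_mul]
    congr 2
    ring

theorem neg_negMin_le_re {N : ℕ} (n : Fin N → ℕ) (a : Fin N → ℂ) {z : ℂ} (hz : ‖z‖ = 1) :
    -negMin n a ≤ (∑ k, a k * z ^ n k).re := by
  obtain ⟨x, hx⟩ := exists_poly_eq n a hz
  rw [← hx]
  exact (isLeast_neg_negMin n a).2 ⟨x, rfl⟩

theorem abs_im_le_conjSup {N : ℕ} (n : Fin N → ℕ) (a : Fin N → ℂ) {z : ℂ} (hz : ‖z‖ = 1) :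
    |(∑ k, a k * z ^ n k).im| ≤ conjSup n a := by
  obtain ⟨x, hx⟩ := exists_poly_eq n a hz
  rw [← hx]
  exact (isGreatest_conjSup n a).2 ⟨x, rfl⟩

theorem conjSup_pos {N : ℕ} {n : Fin N → ℕ} {a : Fin N → ℂ} (hpos : ∀ k, 0 < n k)
    (hn : Function.Injective n) (ha : ∃ k, a k ≠ 0) : 0 < conjSup n a := by
  by_contra! hS
  have h1 : Real.circleAverage (fun z => (∑ k, a k * z ^ n k).im ^ 2) 0 1 ≤ 0 := by
    refine Real.circleAverage_mono_on_of_le_circle (by fun_prop : Continuous fun z : ℂ =>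
      (∑ k, a k * z ^ n k).im ^ 2).continuousOn.circleIntegrable' fun z hz => ?_
    have h := (abs_im_le_conjSup n a (by simpa using hz : ‖z‖ = 1)).trans hS
    rw [abs_nonpos_iff.1 h, zero_pow two_ne_zero]
  rw [circleAverage_im_sq_sum hpos hn] at h1
  obtain ⟨k, hk⟩ := ha
  have h2 : ‖a k‖ ^ 2 ≤ ∑ k, ‖a k‖ ^ 2 :=
    single_le_sum (f := fun k => ‖a k‖ ^ 2) (fun k _ => sq_nonneg _) (mem_univ k)
  have h3 : 0 < ‖a k‖ ^ 2 := by positivity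
  linarith

/-- Read off from `integral_div_sin`, whose integrand is positive. -/
theorem catalanConst_pos : 0 < catalanConst := by
  have h := intervalIntegral.intervalIntegral_pos_of_pos_on intervalIntegrable_div_sin
    (fun t ht => div_pos ht.1 (sin_half_pi_mul_pos (Set.Ioo_subset_Ioc_self ht))) one_pos
  rw [integral_div_sin] at h
  have hp := Real.pi_pos
  have := (div_pos_iff_of_pos_right (by positivity)).1 h
  linarith

theorem sum_norm_sq_div_le_negMin {N : ℕ} {n : Fin N → ℕ} {a : Fin N → ℂ} (hpos : ∀ k, 0 < n k)
    (hn : Function.Injective n) (ha : ∃ k, a k ≠ 0) :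
    π ^ 2 / (32 * catalanConst) * ((∑ k, ‖a k‖ ^ 2) / conjSup n a) ≤ negMin n a := by
  have hp := Real.pi_pos
  have hS := conjSup_pos hpos hn ha
  have hG := catalanConst_pos
  set S := conjSup n a
  set M := negMin n a
  have hq : 0 < π / (2 * S) := by positivity
  set q := π / (2 * S) with hqd
  have h0 : ∑ k, a k * (0 : ℂ) ^ n k = 0 :=
    sum_eq_zero fun k _ => by rw [zero_pow (hpos k).ne', mul_zero]
  -- Adding M makes the real part nonnegative; the factor q scales the bound S on the imaginary part
  -- to π/2.
  have h := circleAverage_im_sq_le (F := fun z => (q : ℂ) * ((∑ k, a k * z ^ n k) + (M : ℂ)))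
    (by fun_prop) (h := q * M) (by rw [h0]; push_cast; ring)
    (fun z hz => by
      rw [Complex.re_ofReal_mul, Complex.add_re, Complex.ofReal_re]
      have : -M ≤ _ := neg_negMin_le_re n a hz
      exact mul_nonneg hq.le (by linarith))
    (fun z hz => by
      rw [Complex.im_ofReal_mul, Complex.add_im, Complex.ofReal_im, add_zero, abs_mul,
        abs_of_pos hq]
      have : _ ≤ S := abs_im_le_conjSup n a hz
      calc _ ≤ q * S := by gcongr
        _ = π / 2 := by rw [hqd]; field_simp)
  simp only [Complex.im_ofReal_mul, Complex.add_im, Complex.ofReal_im, add_zero, mul_pow] at h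
  rw [circleAverage_const_mul, circleAverage_im_sq_sum hpos hn] at h
  have h2 : q * ((∑ k, ‖a k‖ ^ 2) / 2) ≤ 8 / π * catalanConst * M := by nlinarith
  calc π ^ 2 / (32 * catalanConst) * ((∑ k, ‖a k‖ ^ 2) / S)
      = π / (8 * catalanConst) * (q * ((∑ k, ‖a k‖ ^ 2) / 2)) := by rw [hqd]; field_simp; ring
    _ ≤ π / (8 * catalanConst) * (8 / π * catalanConst * M) := by gcongr
    _ = M := by field_simp

theorem negMin_le_of_norm_le {N : ℕ} {n : Fin N → ℕ} {a : Fin N → ℂ} {B : ℝ}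
    (h : ∀ z : ℂ, ‖z‖ = 1 → ‖∑ k, a k * z ^ n k‖ ≤ B) : negMin n a ≤ B := by
  obtain ⟨x, hx⟩ := (isLeast_neg_negMin n a).1
  obtain ⟨z, hz, hxz⟩ := exists_norm_one_poly_eq n a x
  have h1 := (abs_le.1 ((Complex.abs_re_le_norm _).trans (h z hz))).1
  rw [← hxz] at h1
  change (poly n a x).re = _ at hx
  linarith

theorem conjSup_le_of_norm_le {N : ℕ} {n : Fin N → ℕ} {a : Fin N → ℂ} {B : ℝ}
    (h : ∀ z : ℂ, ‖z‖ = 1 → ‖∑ k, a k * z ^ n k‖ ≤ B) : conjSup n a ≤ B := by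
  obtain ⟨x, hx⟩ := (isGreatest_conjSup n a).1
  obtain ⟨z, hz, hxz⟩ := exists_norm_one_poly_eq n a x
  have h1 := (Complex.abs_im_le_norm _).trans (h z hz)
  rw [← hxz] at h1
  change |(poly n a x).im| = _ at hx
  linarith

theorem negMin_rudinShapiro_le {N : ℕ} (hN : 1 ≤ N) :
    negMin (fun k : Fin N => (k : ℕ) + 1) (fun k : Fin N => (RudinShapiro.sign k : ℂ)) ≤
      25 * ((N : ℝ) / conjSup (fun k : Fin N => (k : ℕ) + 1)
        (fun k : Fin N => (RudinShapiro.sign k : ℂ))) := by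
  have hB : ∀ z : ℂ, ‖z‖ = 1 →
      ‖∑ k : Fin N, (RudinShapiro.sign k : ℂ) * z ^ ((k : ℕ) + 1)‖ ≤ 5 * √N := fun z hz => by
    refine le_trans (le_of_eq ?_) (RudinShapiro.norm_partialSum_le hN hz)
    rw [Fin.sum_univ_eq_sum_range fun k => (RudinShapiro.sign k : ℂ) * z ^ (k + 1)]
    simp only [pow_succ, ← mul_assoc]
    rw [← sum_mul, norm_mul, hz, mul_one, RudinShapiro.partialSum]
  have hS : 0 < conjSup (fun k : Fin N => (k : ℕ) + 1)
      (fun k : Fin N => (RudinShapiro.sign k : ℂ)) :=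
    conjSup_pos (fun k => Nat.succ_pos _) (fun i j hij => Fin.ext (by simpa using hij))
      ⟨⟨0, hN⟩, fun h => by simpa [h] using RudinShapiro.norm_sign 0⟩
  have hM := negMin_le_of_norm_le hB
  have hS' := conjSup_le_of_norm_le hB
  rw [← mul_div_assoc, le_div_iff₀ hS]
  calc _ ≤ (5 * √N) * (5 * √N) := mul_le_mul hM hS' hS.le (by positivity)
    _ = 25 * N := by rw [mul_mul_mul_comm, Real.mul_self_sqrt (Nat.cast_nonneg N)]; norm_num

end TrigPoly

theorem mainTheorem3 :
    -- the constant `A_2`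
    (IntervalIntegrable (fun t : ℝ => t ^ ((2 : ℝ) - 1) / Real.sin (π * t / 2))
        MeasureTheory.volume 0 1 ∧
      TrigPoly.A 2 = 16 * TrigPoly.catalanConst / π ^ 2) ∧
    -- the inequality for arbitrary coefficients, not all zero
    (∀ (N : ℕ) (n : Fin N → ℕ) (a : Fin N → ℂ), (∀ k, 0 < n k) → StrictMono n →
      (∃ k, a k ≠ 0) →
      0 < TrigPoly.conjSup n a ∧
      π ^ 2 / (32 * TrigPoly.catalanConst) * ((∑ k, ‖a k‖ ^ 2) / TrigPoly.conjSup n a)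
        ≤ TrigPoly.negMin n a) ∧
    -- the inequality for coefficients of modulus at least one
    (∀ (N : ℕ) (n : Fin N → ℕ) (a : Fin N → ℂ), 1 ≤ N → (∀ k, 0 < n k) → StrictMono n →
      (∀ k, 1 ≤ ‖a k‖) →
      0 < TrigPoly.conjSup n a ∧
      π ^ 2 / (32 * TrigPoly.catalanConst) * ((N : ℝ) / TrigPoly.conjSup n a)
        ≤ TrigPoly.negMin n a) ∧
    -- the order in `N` is optimal, already for frequencies `1, …, N` and coefficients `±1`
    (∃ ε : ℕ → ℝ, (∀ m, ε m = 1 ∨ ε m = -1) ∧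
      ∀ N : ℕ, 1 ≤ N →
        TrigPoly.negMin (fun k : Fin N => (k : ℕ) + 1) (fun k : Fin N => (ε ((k : ℕ) + 1) : ℂ))
          ≤ 25 * ((N : ℝ) / TrigPoly.conjSup (fun k : Fin N => (k : ℕ) + 1)
              (fun k : Fin N => (ε ((k : ℕ) + 1) : ℂ)))) := by
  refine ⟨⟨?_, ?_⟩, fun N n a hpos hn ha => ?_, fun N n a hN hpos hn ha => ?_, ?_⟩
  · refine TrigPoly.intervalIntegrable_div_sin.congr fun t _ => ?_
    norm_num
  · have h : ∀ t : ℝ, t ^ ((2 : ℝ) - 1) = t := fun t => by norm_num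
    rw [TrigPoly.A]
    simp only [h]
    rw [TrigPoly.integral_div_sin]
    ring
  · exact ⟨TrigPoly.conjSup_pos hpos hn.injective ha,
      TrigPoly.sum_norm_sq_div_le_negMin hpos hn.injective ha⟩
  · have hne : ∃ k, a k ≠ 0 := ⟨⟨0, hN⟩, norm_pos_iff.1 (one_pos.trans_le (ha _))⟩
    have hS := TrigPoly.conjSup_pos hpos hn.injective hne
    refine ⟨hS, le_trans ?_ (TrigPoly.sum_norm_sq_div_le_negMin hpos hn.injective hne)⟩
    have hG := TrigPoly.catalanConst_pos
    have hsum : (N : ℝ) ≤ ∑ k, ‖a k‖ ^ 2 := by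
      calc (N : ℝ) = ∑ _k : Fin N, (1 : ℝ) := by simp
        _ ≤ _ := Finset.sum_le_sum fun k _ => one_le_pow₀ (ha k)
    gcongr
  -- The shift is needed because frequencies start at 1 and the signs at 0; the value at m = 0 plays
  -- no role.
  · refine ⟨fun m => RudinShapiro.sign (m - 1), fun m => RudinShapiro.sign_eq_one_or _,
      fun N hN => ?_⟩
    simpa only [Nat.add_sub_cancel] using TrigPoly.negMin_rudinShapiro_le hN
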